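/- Theorem (threshold direct product theorem). Let $\mathcal D\subseteq D^n$ with $D$ a finite set, let $f:\mathcal D\to\{0,1\}$ be a non-constant function, and put $F(x,y)=1$ if $f(x)=f(y)$ and $F(x,y)=0$ otherwise. Let $J$ be the all-ones matrix, $\Delta_i(x,y)=1$ if $x_i=y_i$ and $0$ otherwise, let $\circ$ denote the entrywise product of matrices, and let $$\mathrm{ADV}(F)=\max_{\Gamma}\ \|\Gamma\circ(J-F)\|,$$ where $\|\cdot\|$ is the spectral norm and the maximum is over Hermitian $\mathcal D\times\mathcal D$ matrices $\Gamma$ with $I\pm\Gamma\circ(J-\Delta_i)\succeq 0$ for all $i\in[n]$. For $0\le\lambda\le1$ and $0<q<1$ let $D(\lambda\,\|\,q)=\lambda\ln\frac{\lambda}{q}+(1-\lambda)\ln\frac{1-\lambda}{1-q}$, with $0\ln 0=0$. Let $0\le\delta<1$, let $\frac{1+\sqrt\delta}{2}\le\mu\le 1$, and let $k,K>0$ be integers. Let $\mathcal P$ be a quantum query algorithm that makes $T$ queries to an input $(x^1,\dots,x^k)\in\mathcal D^k$ (a string of $kn$ letters of $D$) and outputs $k$ bits $\mathcal P_1,\dots,\mathcal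 P_k$, where $$T\le\frac{k\delta}{K(1-\delta)}\,\mathrm{ADV}(F).$$ Then the worst-case probability that at least $\mu k$ of the outputs are correct is at most $e^{k/K-kD(\mu\|(1+\sqrt\delta)/2)}$; that is, there is an input $(x^1,\dots,x^k)\in\mathcal D^k$ on which $$\Pr\bigl[\,|\{i\in[k]:\mathcal P_i(x^1,\dots,x^k)=f(x^i)\}|\ge\mu k\,\bigr]\le \exp\!\Bigl(\frac kK-k\,D\Bigl(\mu\,\Big\|\,\frac{1+\sqrt\delta}{2}\Bigr)\Bigr).$$ -/

import Mathlib

open scoped Matrix ComplexOrder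

/-! ## Quantum query algorithms -/

/-- A quantum query algorithm with `T` queries to an input `z : I → A` (positions `I`, alphabet
`A`), with output in `O`.  The Hilbert space has orthonormal basis `|i, b, w⟩`, where `i : I` is
the query register, `b : R` is the answer register and `w : W` is the workspace; letters of the
alphabet are written in the answer register through the encoding `enc : A ↪ R` (for instance
`R = ZMod q` or `R = Fin l → ZMod 2`, with bitwise addition). -/
structure QueryAlgorithm (I A R W O : Type*) [Fintype I] [Fintype R] [Fintype W]
    [DecidableEq I] [DecidableEq R] [DecidableEq W] (T : ℕ) where
  /-- the encoding of letters into the answer register -/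
  enc : A ↪ R
  /-- the input-independent initial basis state -/
  init : I × R × W
  /-- `U t` is the input-independent unitary applied after the first `t` queries
  (only `U 0, …, U T` are used) -/
  U : ℕ → Matrix.unitaryGroup (I × R × W) ℂ
  /-- the output produced when the final measurement in the standard basis gives `|i, b, w⟩` -/
  out : I × R × W → O

namespace QueryAlgorithm

variable {I A R W O : Type*} [Fintype I] [Fintype R] [Fintype W]
  [DecidableEq I] [DecidableEq R] [DecidableEq W] {T : ℕ}

/-- The query operator, the linear map with `|i, b, w⟩ ↦ |i, b + z i, w⟩` on basis states. -/
def query [AddCommGroup R] (P : QueryAlgorithm I A R W O T) (z : I → A)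
    (ψ : I × R × W → ℂ) : I × R × W → ℂ :=
  fun s => ψ (s.1, s.2.1 - P.enc (z s.1), s.2.2)

/-- The state `U t · O_z · U (t - 1) ⋯ O_z · U 0 |init⟩` on input `z` after `t` queries. -/
def state [AddCommGroup R] (P : QueryAlgorithm I A R W O T) (z : I → A) :
    ℕ → (I × R × W → ℂ)
  | 0 => (P.U 0 : Matrix (I × R × W) (I × R × W) ℂ) *ᵥ Pi.single P.init 1
  | t + 1 => (P.U (t + 1) : Matrix (I × R × W) (I × R × W) ℂ) *ᵥ P.query z (P.state z t)

open Classical in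
/-- The probability that the output on input `z`, after all `T` queries, satisfies `E`. -/
noncomputable def prob [AddCommGroup R] (P : QueryAlgorithm I A R W O T) (z : I → A)
    (E : O → Prop) : ℝ :=
  ∑ s : I × R × W, if E (P.out s) then ‖P.state z T s‖ ^ 2 else 0

end QueryAlgorithm

/-! ## The additive adversary bound -/

section Adversary

variable {n : ℕ} {A : Type*} [DecidableEq A]

/-- The Gram matrix `F (x, y) = δ_{f x, f y}` of a function `f`. -/
def gramMatrix {X E : Type*} [DecidableEq E] (f : X → E) : Matrix X X ℂ :=
  Matrix.of fun x y => if f x = f y then 1 else 0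

/-- The all-ones matrix `J`. -/
def allOnes (X : Type*) : Matrix X X ℂ := Matrix.of fun _ _ => 1

/-- `Δ_i (x, y) = δ_{x_i, y_i}`. -/
def coordMatrix (dom : Finset (Fin n → A)) (i : Fin n) : Matrix dom dom ℂ :=
  Matrix.of fun x y => if x.1 i = y.1 i then 1 else 0

/-- The feasible adversary matrices: Hermitian `Γ` such that `I ± Γ ∘ (J - Δ_i) ⪰ 0` for every
`i`, where `∘` is the entrywise product. -/
def IsAdversaryMatrix (dom : Finset (Fin n → A)) (Γ : Matrix dom dom ℂ) : Prop :=
  Γ.IsHermitian ∧ ∀ i : Fin n,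
    (1 + Γ ⊙ (allOnes dom - coordMatrix dom i)).PosSemidef ∧
    (1 - Γ ⊙ (allOnes dom - coordMatrix dom i)).PosSemidef

/-- The additive adversary bound of a target Gram matrix `σ`: the maximum of the spectral norm
`‖Γ ∘ (J - σ)‖` over all feasible adversary matrices `Γ`. -/
noncomputable def additiveAdversary (dom : Finset (Fin n → A)) (σ : Matrix dom dom ℂ) : ℝ :=
  sSup {r : ℝ | ∃ Γ : Matrix dom dom ℂ, IsAdversaryMatrix dom Γ ∧
    r = ‖Matrix.toEuclideanCLM (n := dom) (𝕜 := ℂ) (Γ ⊙ (allOnes dom - σ))‖}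

end Adversary

/-! ## Direct products -/

/-- The string of all letters of a `k`-tuple of inputs; position `(p, q)` holds the `q`-th letter
of the `p`-th input. -/
def jointInput {n k : ℕ} {A : Type*} {dom : Finset (Fin n → A)} (x : Fin k → dom) :
    Fin k × Fin n → A :=
  fun pq => (x pq.1).1 pq.2

/-- The set of indices `i` for which the `i`-th output `o i` equals `f (x i)`. -/
def correctOutputs {k : ℕ} {X : Type*} (f : X → Bool) (x : Fin k → X) (o : Fin k → Bool) :
    Finset (Fin k) :=
  Finset.univ.filter fun i => o i = f (x i)

/-- The binary relative entropy `D(p ‖ q)` (with `0 ln 0 = 0`, as `Real.log 0 = 0`). -/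
noncomputable def binaryRelEntropy (p q : ℝ) : ℝ :=
  p * Real.log (p / q) + (1 - p) * Real.log ((1 - p) / (1 - q))

/-!
The proof is a multiplicative adversary argument.  Let `B` be an adversary matrix whose blocks
inside `f = 0` and inside `f = 1` vanish, with top eigenvalue `d` and top eigenvector `v`; such a
`B` exists with `d` at least half the adversary bound (`exists_off_diagonal_adversaryMatrix`).
Put `G = 1 + γ (d - B)`, so that `G ≥ 1` and `G v = v`, and measure the progress of an algorithm by
`W t = ∑ (G ⊗ ⋯ ⊗ G) (z, z') ⟨v_z ψ_z, v_z' ψ_z'⟩`, where `ψ_z` is the state on input `z` after `t`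
queries and `v_z = ∏ p, v (z p)`.

* Initially `ψ_z` does not depend on `z` and `W 0 = 1`.  Unitaries do not change `W`.  A query to
  letter `i` of one of the inputs changes only the part `γ B ∘ (J - Δ_i)` of the corresponding
  factor, which is between `-γ` and `γ`, hence multiplies `W` by at most `1 + 2 γ`
  (`familyForm_query_le`).
* Let `Π_o` be the projection onto the inputs with `f = o`.  If `γ d = (1 - ε) / (2 ε)` then
  `Π_o ≤ (1 + ε) / 2 • G`
  (`smul_multiplicativeMatrix_sub_indicator_posSemidef`).  So, up to the factor `W T`, the output
  bits are no better than independent bits that are correct with probability `q = (1 + ε) / 2`: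
  for `α ≥ β ≥ 0`, the mean of `α ^ #correct * β ^ #wrong` over inputs drawn with weights
  `|v_z| ^ 2` is at most `(α q + β (1 - q)) ^ k * W T` (the proof of `exists_input_prob_le`).

With the likelihood ratios `α = μ / q` and `β = (1 - μ) / (1 - q)` the first factor is `1`, and the
reward of an outcome with at least `μ k` correct bits is at least `exp (k D(μ ‖ q))`
(`exp_mul_binaryRelEntropy_le`).  For `ε = √δ` the bound on `T` gives
`W T ≤ exp (2 γ T) ≤ exp (k / K)`.  If `δ = 0` then `T = 0` and `W T = 1`; a small positive `ε` is
used instead, and the factor `exp (k / K)` pays for it.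
-/

/-! ### Quadratic forms of matrices on families of vectors -/

section QuadraticForm

variable {Z S : Type*} [Fintype Z] [Fintype S]

/-- The real quadratic form `a ↦ ⟨a, M a⟩` of a complex matrix. -/
noncomputable def quadForm (M : Matrix Z Z ℂ) (a : Z → ℂ) : ℝ := (star a ⬝ᵥ M *ᵥ a).re

/-- The sum of the quadratic form `⟨a, M a⟩` over the coordinates `s` of a family of vectors `φ z`,
that is, the form of `M ⊗ 1`.  It is the real part of `∑ M (z, z') ⟨φ z, φ z'⟩`. -/
noncomputable def familyForm (M : Matrix Z Z ℂ) (φ : Z → S → ℂ) : ℝ :=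
  ∑ s, quadForm M fun z => φ z s

theorem quadForm_add (M N : Matrix Z Z ℂ) (a : Z → ℂ) :
    quadForm (M + N) a = quadForm M a + quadForm N a := by
  simp [quadForm, Matrix.add_mulVec]

theorem quadForm_sub (M N : Matrix Z Z ℂ) (a : Z → ℂ) :
    quadForm (M - N) a = quadForm M a - quadForm N a := by
  simp [quadForm, Matrix.sub_mulVec]

theorem quadForm_smul (c : ℝ) (M : Matrix Z Z ℂ) (a : Z → ℂ) :
    quadForm (c • M) a = c * quadForm M a := by
  simp [quadForm, Matrix.smul_mulVec]

theorem Matrix.PosSemidef.quadForm_nonneg {M : Matrix Z Z ℂ} (hM : M.PosSemidef) (a : Z → ℂ) :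
    0 ≤ quadForm M a := (Complex.nonneg_iff.1 (hM.dotProduct_mulVec_nonneg a)).1

theorem quadForm_diagonal [DecidableEq Z] (w : Z → ℝ) (a : Z → ℂ) :
    quadForm (Matrix.diagonal fun z => (w z : ℂ)) a = ∑ z, w z * ‖a z‖ ^ 2 := by
  simp only [quadForm, dotProduct, Matrix.mulVec_diagonal, Complex.re_sum]
  refine Finset.sum_congr rfl fun z _ => ?_
  have h : star a z * (w z * a z) = ((w z * ‖a z‖ ^ 2 : ℝ) : ℂ) := by
    have := Complex.conj_mul' (a z)
    simp only [Pi.star_apply, RCLike.star_def]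
    push_cast
    rw [← this]; ring
  rw [h, Complex.ofReal_re]

theorem familyForm_add (M N : Matrix Z Z ℂ) (φ : Z → S → ℂ) :
    familyForm (M + N) φ = familyForm M φ + familyForm N φ := by
  simp [familyForm, quadForm_add, Finset.sum_add_distrib]

theorem familyForm_sub (M N : Matrix Z Z ℂ) (φ : Z → S → ℂ) :
    familyForm (M - N) φ = familyForm M φ - familyForm N φ := by
  simp [familyForm, quadForm_sub, Finset.sum_sub_distrib]

theorem familyForm_smul (c : ℝ) (M : Matrix Z Z ℂ) (φ : Z → S → ℂ) :
    familyForm (c • M) φ = c * familyForm M φ := by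
  simp [familyForm, quadForm_smul, Finset.mul_sum]

theorem Matrix.PosSemidef.familyForm_nonneg {M : Matrix Z Z ℂ} (hM : M.PosSemidef)
    (φ : Z → S → ℂ) : 0 ≤ familyForm M φ :=
  Finset.sum_nonneg fun _ _ => hM.quadForm_nonneg _

theorem familyForm_eq_gram (M : Matrix Z Z ℂ) (φ : Z → S → ℂ) :
    familyForm M φ = (∑ z, ∑ z', M z z' * (star (φ z) ⬝ᵥ φ z')).re := by
  simp only [familyForm, quadForm, ← Complex.re_sum, dotProduct, Matrix.mulVec, Finset.mul_sum,
    Pi.star_apply]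
  congr 1
  rw [Finset.sum_comm]
  refine Finset.sum_congr rfl fun z _ => ?_
  rw [Finset.sum_comm]
  refine Finset.sum_congr rfl fun z' _ => Finset.sum_congr rfl fun s _ => ?_
  ring

/-- A common unitary does not change the Gram matrix of a family. -/
theorem familyForm_unitary [DecidableEq S] (M : Matrix Z Z ℂ) (U : Matrix.unitaryGroup S ℂ)
    (φ : Z → S → ℂ) :
    familyForm M (fun z => (U : Matrix S S ℂ) *ᵥ φ z) = familyForm M φ := by
  rw [familyForm_eq_gram, familyForm_eq_gram]
  have h : (U : Matrix S S ℂ)ᴴ * (U : Matrix S S ℂ) = 1 := Matrix.UnitaryGroup.star_mul_self U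
  have key : ∀ z z', star ((U : Matrix S S ℂ) *ᵥ φ z) ⬝ᵥ ((U : Matrix S S ℂ) *ᵥ φ z') =
      star (φ z) ⬝ᵥ φ z' := by
    intro z z'
    rw [Matrix.star_mulVec, Matrix.dotProduct_mulVec, Matrix.vecMul_vecMul, h, Matrix.vecMul_one]
  simp only [key]

/-- Permuting the coordinates of each `φ z` by a permutation that agrees on `z` and `z'` whenever
`M z z' ≠ 0` leaves all the inner products that matter unchanged. -/
theorem familyForm_perm (M : Matrix Z Z ℂ) (π : Z → Equiv.Perm S)
    (h : ∀ z z', M z z' ≠ 0 → π z = π z') (φ : Z → S → ℂ) :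
    familyForm M (fun z s => φ z (π z s)) = familyForm M φ := by
  rw [familyForm_eq_gram, familyForm_eq_gram]
  congr 1
  refine Finset.sum_congr rfl fun z _ => Finset.sum_congr rfl fun z' _ => ?_
  by_cases hM : M z z' = 0
  · simp [hM]
  · congr 1
    simp only [dotProduct, Pi.star_apply, h z z' hM]
    exact Equiv.sum_comp (π z') fun s => star (φ z s) * φ z' s

theorem familyForm_prod {I : Type*} [Fintype I] (M : Matrix Z Z ℂ) (φ : Z → I × S → ℂ) :
    familyForm M φ = ∑ i, familyForm M fun z s => φ z (i, s) := by
  simp only [familyForm, Fintype.sum_prod_type]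

end QuadraticForm

/-! ### Tensor products of matrices -/

section TensorProduct

variable {ι X : Type*} [Fintype ι]

/-- The tensor product of a family of matrices, as a matrix indexed by tuples. -/
def tensorMatrix (M : ι → Matrix X X ℂ) : Matrix (ι → X) (ι → X) ℂ :=
  Matrix.of fun z z' => ∏ p, M p (z p) (z' p)

theorem tensorMatrix_apply (M : ι → Matrix X X ℂ) (z z' : ι → X) :
    tensorMatrix M z z' = ∏ p, M p (z p) (z' p) := rfl

theorem tensorMatrix_ne_zero {M : ι → Matrix X X ℂ} {z z' : ι → X} (h : tensorMatrix M z z' ≠ 0)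
    (p : ι) : M p (z p) (z' p) ≠ 0 :=
  fun h0 => h (Finset.prod_eq_zero (Finset.mem_univ p) h0)

theorem tensorMatrix_diagonal [DecidableEq X] [DecidableEq ι] (w : ι → X → ℝ) :
    tensorMatrix (fun p => Matrix.diagonal fun x => (w p x : ℂ)) =
      Matrix.diagonal fun z => ((∏ p, w p (z p) : ℝ) : ℂ) := by
  ext z z'
  by_cases h : z = z'
  · subst h; simp [tensorMatrix_apply]
  · obtain ⟨p, hp⟩ := Function.ne_iff.1 h
    rw [Matrix.diagonal_apply_ne _ h, tensorMatrix_apply]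
    exact Finset.prod_eq_zero (Finset.mem_univ p) (Matrix.diagonal_apply_ne _ hp)

theorem tensorMatrix_const_smul (c : ℝ) (M : ι → Matrix X X ℂ) :
    tensorMatrix (fun p => c • M p) = c ^ Fintype.card ι • tensorMatrix M := by
  ext z z'
  simp [tensorMatrix_apply, Finset.prod_mul_distrib]

section Update

variable [DecidableEq ι]

theorem tensorMatrix_update_apply (M : ι → Matrix X X ℂ) (p : ι) (A : Matrix X X ℂ)
    (z z' : ι → X) : tensorMatrix (Function.update M p A) z z' =
      A (z p) (z' p) * ∏ r ∈ Finset.univ.erase p, M r (z r) (z' r) := by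
  rw [tensorMatrix_apply, ← Finset.mul_prod_erase _ _ (Finset.mem_univ p), Function.update_self]
  congr 1
  refine Finset.prod_congr rfl fun r hr => ?_
  rw [Function.update_of_ne (Finset.ne_of_mem_erase hr)]

theorem tensorMatrix_update_add (M : ι → Matrix X X ℂ) (p : ι) (A B : Matrix X X ℂ) :
    tensorMatrix (Function.update M p (A + B)) =
      tensorMatrix (Function.update M p A) + tensorMatrix (Function.update M p B) := by
  ext z z'
  simp only [Matrix.add_apply, tensorMatrix_update_apply, add_mul]

theorem tensorMatrix_update_sub (M : ι → Matrix X X ℂ) (p : ι) (A B : Matrix X X ℂ) :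
    tensorMatrix (Function.update M p (A - B)) =
      tensorMatrix (Function.update M p A) - tensorMatrix (Function.update M p B) := by
  ext z z'
  simp only [Matrix.sub_apply, tensorMatrix_update_apply, sub_mul]

theorem tensorMatrix_update_smul (M : ι → Matrix X X ℂ) (p : ι) (c : ℝ) (A : Matrix X X ℂ) :
    tensorMatrix (Function.update M p (c • A)) =
      c • tensorMatrix (Function.update M p A) := by
  ext z z'
  simp only [Matrix.smul_apply, tensorMatrix_update_apply, smul_mul_assoc]

end Update

variable [Fintype X]

/-- A tensor product of positive semidefinite matrices is an entrywise product of positive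
semidefinite matrices, so the Schur product theorem applies. -/
theorem tensorMatrix_posSemidef {M : ι → Matrix X X ℂ} (hM : ∀ p, (M p).PosSemidef) :
    (tensorMatrix M).PosSemidef := by
  classical
  suffices h : ∀ s : Finset ι,
      (Matrix.of fun z z' : ι → X => ∏ p ∈ s, M p (z p) (z' p)).PosSemidef from h Finset.univ
  intro s
  induction s using Finset.induction_on with
  | empty =>
    convert! Matrix.posSemidef_vecMulVec_self_star (fun _ : ι → X => (1 : ℂ)) using 1
    ext z z'
    simp [Matrix.vecMulVec_apply]
  | insert p s hp ih =>
    convert! ((hM p).submatrix fun z : ι → X => z p).hadamard ih using 1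
    ext z z'
    simp [Finset.prod_insert hp]

/-- The tensor product is monotone for the Loewner order on positive semidefinite matrices. -/
theorem tensorMatrix_mono {A B : ι → Matrix X X ℂ} (hA : ∀ p, (A p).PosSemidef)
    (hAB : ∀ p, (B p - A p).PosSemidef) : (tensorMatrix B - tensorMatrix A).PosSemidef := by
  classical
  suffices h : ∀ s : Finset ι,
      (tensorMatrix (s.piecewise B A) - tensorMatrix A).PosSemidef by
    simpa using h Finset.univ
  intro s
  induction s using Finset.induction_on with
  | empty => simpa using Matrix.PosSemidef.zero
  | insert p s hp ih =>
    have hB : ∀ r, (B r).PosSemidef := fun r => by simpa using (hAB r).add (hA r)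
    have hs : Function.update (s.piecewise B A) p (A p) = s.piecewise B A := by
      rw [← Finset.piecewise_eq_of_notMem s B A hp, Function.update_eq_self]
    have h1 : (tensorMatrix (Function.update (s.piecewise B A) p (B p - A p))).PosSemidef := by
      refine tensorMatrix_posSemidef fun r => ?_
      by_cases hr : r = p
      · subst hr; simpa using hAB r
      · rw [Function.update_of_ne hr]
        by_cases hrs : r ∈ s
        · simpa [hrs] using hB r
        · simpa [hrs] using hA r
    rw [tensorMatrix_update_sub, hs, ← Finset.piecewise_insert] at h1
    simpa using h1.add ih

/-- The quadratic form of a tensor product at a product vector. -/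
theorem dotProduct_tensorMatrix_mulVec [DecidableEq ι] (M : ι → Matrix X X ℂ) (v : X → ℂ) :
    star (fun z : ι → X => ∏ p, v (z p)) ⬝ᵥ tensorMatrix M *ᵥ (fun z => ∏ p, v (z p)) =
      ∏ p, (star v ⬝ᵥ M p *ᵥ v) := by
  simp only [dotProduct, Matrix.mulVec, Finset.mul_sum, Finset.prod_univ_sum,
    Fintype.piFinset_univ, Pi.star_apply, tensorMatrix_apply, star_prod]
  refine Finset.sum_congr rfl fun z _ => Finset.sum_congr rfl fun z' _ => ?_
  simp only [Finset.prod_mul_distrib]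

end TensorProduct

/-! ### The multiplicative adversary matrix -/

section Multiplicative

variable {X : Type*} [Fintype X] [DecidableEq X]

/-- The multiplicative adversary matrix `1 + γ (d - B)` built from an additive adversary matrix `B`
with largest eigenvalue `d`.  Its least eigenvalue is `1`, on the top eigenvectors of `B`. -/
noncomputable def multiplicativeMatrix (B : Matrix X X ℂ) (γ d : ℝ) : Matrix X X ℂ :=
  1 + γ • (d • (1 : Matrix X X ℂ) - B)

variable {B : Matrix X X ℂ} {γ d : ℝ}

omit [Fintype X] in
theorem multiplicativeMatrix_sub_one_posSemidef (hγ : 0 ≤ γ)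
    (hB : (d • (1 : Matrix X X ℂ) - B).PosSemidef) :
    (multiplicativeMatrix B γ d - 1).PosSemidef := by
  rw [multiplicativeMatrix, add_sub_cancel_left]
  exact hB.smul hγ

/-- The projection onto the inputs with a given value of `f` is at most `(1 + ε) / 2` times the
multiplicative adversary matrix.  Since `B` is off-diagonal with respect to `f`, conjugating it by
a diagonal matrix `L` equal to `c` where `f = o` and to `c⁻¹` elsewhere does not change it, and the
difference of the two sides is a positive multiple of `L (d - B) L` when
`c ^ 2 = (1 - ε) / (1 + ε)`. -/
theorem smul_multiplicativeMatrix_sub_indicator_posSemidef {f : X → Bool} {ε : ℝ} (hε0 : 0 < ε)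
    (hε1 : ε < 1) (hγ : 0 ≤ γ) (hγd : γ * d = (1 - ε) / (2 * ε))
    (hoff : ∀ x y, f x = f y → B x y = 0) (hB : (d • (1 : Matrix X X ℂ) - B).PosSemidef)
    (o : Bool) :
    (((1 + ε) / 2) • multiplicativeMatrix B γ d -
      Matrix.diagonal fun x => ((if o = f x then (1 : ℝ) else 0 : ℝ) : ℂ)).PosSemidef := by
  have hpos : 0 < (1 - ε) / (1 + ε) := div_pos (by linarith) (by linarith)
  obtain ⟨c, hc, hc2⟩ : ∃ c : ℝ, 0 < c ∧ c * c = (1 - ε) / (1 + ε) :=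
    ⟨√((1 - ε) / (1 + ε)), Real.sqrt_pos.2 hpos, Real.mul_self_sqrt hpos.le⟩
  have hc2' : c⁻¹ * c⁻¹ = (1 + ε) / (1 - ε) := by rw [← mul_inv, hc2, inv_div]
  set l : X → ℝ := fun x => if o = f x then c else c⁻¹ with hl
  have hL : (Matrix.diagonal fun x => (l x : ℂ))ᴴ = Matrix.diagonal fun x => (l x : ℂ) := by
    rw [Matrix.diagonal_conjTranspose]; congr 1; ext x; simp
  have h := (hB.mul_mul_conjTranspose_same (Matrix.diagonal fun x => (l x : ℂ))).smul
    (mul_nonneg (by linarith : 0 ≤ (1 + ε) / 2) hγ)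
  rw [hL] at h
  convert! h using 1
  ext x y
  have hε1' : (1 : ℝ) - ε ≠ 0 := by linarith
  have hε2' : (1 : ℝ) + ε ≠ 0 := by linarith
  simp only [multiplicativeMatrix, Matrix.sub_apply, Matrix.smul_apply, Matrix.add_apply,
    Matrix.diagonal_mul, Matrix.mul_diagonal, Complex.real_smul]
  by_cases hxy : x = y
  · subst hxy
    simp only [Matrix.one_apply_eq, hoff x x rfl, Matrix.diagonal_apply_eq]
    by_cases ho : o = f x
    · have e : (1 + ε) / 2 * (1 + γ * d) - 1 = (1 + ε) / 2 * γ * (c * d * c) := by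
        rw [show (1 + ε) / 2 * γ * (c * d * c) = (1 + ε) / 2 * (γ * d) * (c * c) by ring, hc2, hγd]
        field_simp; ring
      have e' := congrArg (fun r : ℝ => (r : ℂ)) e
      push_cast at e'
      simpa [hl, ho] using e'
    · have e : (1 + ε) / 2 * (1 + γ * d) = (1 + ε) / 2 * γ * (c⁻¹ * d * c⁻¹) := by
        rw [show (1 + ε) / 2 * γ * (c⁻¹ * d * c⁻¹) = (1 + ε) / 2 * (γ * d) * (c⁻¹ * c⁻¹) by ring,
          hc2', hγd]
        field_simp; ring
      have e' := congrArg (fun r : ℝ => (r : ℂ)) e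
      push_cast at e'
      simpa [hl, ho] using e'
  · rw [Matrix.one_apply_ne hxy, Matrix.diagonal_apply_ne _ hxy]
    by_cases hf : f x = f y
    · simp [hoff x y hf]
    · have e : l x * l y = 1 := by
        simp only [hl]
        by_cases hx : o = f x
        · have hy : o ≠ f y := fun h => hf (hx.symm.trans h)
          simp only [if_pos hx, if_neg hy]; exact mul_inv_cancel₀ hc.ne'
        · have hy : o = f y := by
            revert hx hf; cases o <;> cases f x <;> cases f y <;> simp
          simp only [if_neg hx, if_pos hy]; exact inv_mul_cancel₀ hc.ne'
      have e' := congrArg (fun r : ℝ => (r : ℂ)) e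
      push_cast at e' ⊢
      linear_combination ((1 + ε) / 2 * γ * B x y : ℂ) * e'

/-- Rewarding a correct bit by `α` and a wrong bit by `β ≤ α` costs at most the expected reward of a
bit that is correct with probability `(1 + ε) / 2`. -/
theorem smul_multiplicativeMatrix_sub_weight_posSemidef {f : X → Bool} {ε α β : ℝ} (hε0 : 0 < ε)
    (hε1 : ε < 1) (hγ : 0 ≤ γ) (hγd : γ * d = (1 - ε) / (2 * ε))
    (hoff : ∀ x y, f x = f y → B x y = 0) (hB : (d • (1 : Matrix X X ℂ) - B).PosSemidef)
    (hβ : 0 ≤ β) (hβα : β ≤ α) (o : Bool) :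
    (((α - β) * ((1 + ε) / 2) + β) • multiplicativeMatrix B γ d -
      Matrix.diagonal fun x => ((if o = f x then α else β : ℝ) : ℂ)).PosSemidef := by
  convert! ((smul_multiplicativeMatrix_sub_indicator_posSemidef hε0 hε1 hγ hγd hoff hB o).smul
    (sub_nonneg.2 hβα)).add ((multiplicativeMatrix_sub_one_posSemidef hγ hB).smul hβ) using 1
  ext x y
  by_cases hxy : x = y
  · subst hxy
    by_cases ho : o = f x <;> simp [ho] <;> ring
  · simp [hxy]; ring

end Multiplicative

/-! ### The effect of a query on the progress measure -/

section Query

variable {ι X κ S : Type*} [Fintype ι] [DecidableEq ι] [Fintype X] [DecidableEq X] [Fintype S]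

/-- A query to a letter `e (z p)` of the `p`-th input increases the form of `G ⊗ ⋯ ⊗ G` by a factor
of at most `1 + 2 γ`.  In the `p`-th factor, `G = E - γ N`, where the part `E` links only inputs
with equal letters and is not affected by the query, and `-1 ≤ N ≤ 1 ≤ G`. -/
theorem familyForm_query_le {G E N : Matrix X X ℂ} {γ : ℝ} (hγ : 0 ≤ γ)
    (hG : (G - 1).PosSemidef) (hEN : G = E - γ • N) (hN1 : (1 + N).PosSemidef)
    (hN2 : (1 - N).PosSemidef) (e : X → κ) (hE : ∀ x y, E x y ≠ 0 → e x = e y)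
    (π : κ → Equiv.Perm S) (p : ι) (φ : (ι → X) → S → ℂ) :
    familyForm (tensorMatrix fun _ => G) (fun z s => φ z (π (e (z p)) s)) ≤
      (1 + 2 * γ) * familyForm (tensorMatrix fun _ => G) φ := by
  set M : ι → Matrix X X ℂ := fun _ => G with hM
  have hGp : G.PosSemidef := by simpa using hG.add Matrix.PosSemidef.one
  have hup : ∀ A : Matrix X X ℂ, A.PosSemidef →
      (tensorMatrix (Function.update M p A)).PosSemidef := by
    intro A hA
    refine tensorMatrix_posSemidef fun r => ?_
    by_cases hr : r = p
    · subst hr; simpa using hA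
    · simpa [hr, hM] using hGp
  have hMp : tensorMatrix M = tensorMatrix (Function.update M p E) -
      γ • tensorMatrix (Function.update M p N) := by
    rw [← tensorMatrix_update_smul, ← tensorMatrix_update_sub, ← hEN]
    congr 1
    exact (Function.update_eq_self p M).symm
  set φ' : (ι → X) → S → ℂ := fun z s => φ z (π (e (z p)) s) with hφ'
  have hinv : ∀ A : Matrix X X ℂ, (∀ x y, A x y ≠ 0 → e x = e y) →
      familyForm (tensorMatrix (Function.update M p A)) φ' =
        familyForm (tensorMatrix (Function.update M p A)) φ := by
    intro A hA
    have h : ∀ z z', tensorMatrix (Function.update M p A) z z' ≠ 0 →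
        π (e (z p)) = π (e (z' p)) := by
      intro z z' h
      have h' : A (z p) (z' p) ≠ 0 := by simpa using tensorMatrix_ne_zero h p
      rw [hA _ _ h']
    exact familyForm_perm _ _ h φ
  have hone : ∀ x y, (1 : Matrix X X ℂ) x y ≠ 0 → e x = e y := by
    intro x y h
    by_contra hxy
    exact h (Matrix.one_apply_ne fun h => hxy (h ▸ rfl))
  have h1 := (hup _ hN1).familyForm_nonneg φ'
  have h2 := (hup _ hN2).familyForm_nonneg φ
  have h3 := (hup _ hG).familyForm_nonneg φ
  rw [tensorMatrix_update_add, familyForm_add, hinv 1 hone] at h1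
  rw [tensorMatrix_update_sub, familyForm_sub] at h2 h3
  rw [show Function.update M p G = M from Function.update_eq_self p M] at h3
  have h4 : familyForm (tensorMatrix M) φ' =
      familyForm (tensorMatrix (Function.update M p E)) φ -
        γ * familyForm (tensorMatrix (Function.update M p N)) φ' := by
    rw [hMp, familyForm_sub, familyForm_smul, hinv E hE]
  have h5 : familyForm (tensorMatrix M) φ =
      familyForm (tensorMatrix (Function.update M p E)) φ -
        γ * familyForm (tensorMatrix (Function.update M p N)) φ := by
    rw [hMp, familyForm_sub, familyForm_smul]
  have h6 := mul_nonneg hγ h1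
  have h7 := mul_nonneg hγ h2
  have h8 := mul_nonneg hγ h3
  linarith

end Query

/-! ### The progress of a query algorithm -/

namespace QueryAlgorithm

variable {I A R W O : Type*} [Fintype I] [Fintype R] [Fintype W]
  [DecidableEq I] [DecidableEq R] [DecidableEq W] [AddCommGroup R] {T : ℕ}

/-- The states on all inputs after `t` queries, each scaled by an amplitude of its input. -/
def weightedState {Z : Type*} (P : QueryAlgorithm I A R W O T) (V : Z → ℂ) (inp : Z → I → A)
    (t : ℕ) (z : Z) : I × R × W → ℂ :=
  V z • P.state (inp z) t

theorem query_smul (P : QueryAlgorithm I A R W O T) (z : I → A) (c : ℂ) (ψ : I × R × W → ℂ) :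
    P.query z (c • ψ) = c • P.query z ψ := rfl

/-- The shift `b ↦ b - enc a` of the answer register. -/
def shiftPerm (P : QueryAlgorithm I A R W O T) (a : A) : Equiv.Perm (R × W) :=
  (Equiv.subRight (P.enc a)).prodCongr (Equiv.refl W)

theorem weightedState_succ {Z : Type*} (P : QueryAlgorithm I A R W O T) (V : Z → ℂ)
    (inp : Z → I → A) (t : ℕ) (z : Z) :
    P.weightedState V inp (t + 1) z =
      (P.U (t + 1) : Matrix (I × R × W) (I × R × W) ℂ) *ᵥ
        P.query (inp z) (P.weightedState V inp t z) := by
  simp only [weightedState, state, query_smul, Matrix.mulVec_smul]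

theorem familyForm_weightedState_zero {Z : Type*} [Fintype Z] (P : QueryAlgorithm I A R W O T)
    (V : Z → ℂ) (inp : Z → I → A) (M : Matrix Z Z ℂ) :
    familyForm M (P.weightedState V inp 0) = quadForm M V := by
  have h : P.weightedState V inp 0 = fun z =>
      (P.U 0 : Matrix (I × R × W) (I × R × W) ℂ) *ᵥ (V z • Pi.single P.init 1) := by
    ext1 z
    simp only [weightedState, state, Matrix.mulVec_smul]
  rw [h, familyForm_unitary, familyForm, Finset.sum_eq_single P.init]
  · congr 1; ext z; simp
  · intro s _ hs
    simp [quadForm, Pi.single_eq_of_ne hs, dotProduct]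
  · simp

end QueryAlgorithm

section Progress

variable {n k : ℕ} {A : Type*} [DecidableEq A] {dom : Finset (Fin n → A)}
  {R W : Type*} [AddCommGroup R] [Fintype R] [DecidableEq R] [Fintype W] [DecidableEq W]
  {O : Type*} {T : ℕ}

/-- Splitting the multiplicative adversary matrix along a letter: `B ∘ Δ_i` is unaffected by a query
to letter `i`, and `B ∘ (J - Δ_i)` is bounded by feasibility. -/
theorem familyForm_weightedState_succ_le
    (P : QueryAlgorithm (Fin k × Fin n) A R W O T) {B : Matrix dom dom ℂ} {γ d : ℝ} (hγ : 0 ≤ γ)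
    (hadv : IsAdversaryMatrix dom B) (hB : (d • (1 : Matrix dom dom ℂ) - B).PosSemidef)
    (V : (Fin k → dom) → ℂ) (t : ℕ) :
    familyForm (tensorMatrix fun _ => multiplicativeMatrix B γ d)
        (P.weightedState V jointInput (t + 1)) ≤
      (1 + 2 * γ) * familyForm (tensorMatrix fun _ => multiplicativeMatrix B γ d)
        (P.weightedState V jointInput t) := by
  have h : P.weightedState V jointInput (t + 1) = fun z =>
      (P.U (t + 1) : Matrix ((Fin k × Fin n) × R × W) ((Fin k × Fin n) × R × W) ℂ) *ᵥ
        P.query (jointInput z) (P.weightedState V jointInput t z) :=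
    funext fun z => P.weightedState_succ V jointInput t z
  rw [h, familyForm_unitary, familyForm_prod, familyForm_prod, Finset.mul_sum]
  refine Finset.sum_le_sum fun i _ => ?_
  have hG : multiplicativeMatrix B γ d =
      (multiplicativeMatrix B γ d + γ • (B ⊙ (allOnes dom - coordMatrix dom i.2))) -
        γ • (B ⊙ (allOnes dom - coordMatrix dom i.2)) := by simp
  refine familyForm_query_le hγ (multiplicativeMatrix_sub_one_posSemidef hγ hB) hG
    (hadv.2 i.2).1 (hadv.2 i.2).2 (fun x : dom => x.1 i.2) (fun x y hxy => ?_) P.shiftPerm i.1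
    (fun z s => P.weightedState V jointInput t z (i, s))
  by_contra hne
  have hne' : x ≠ y := fun h => hne (h ▸ rfl)
  apply hxy
  have hc : coordMatrix dom i.2 x y = 0 := if_neg hne
  simp [multiplicativeMatrix, hc, hne', allOnes]

theorem familyForm_weightedState_le
    (P : QueryAlgorithm (Fin k × Fin n) A R W O T) {B : Matrix dom dom ℂ} {γ d : ℝ} (hγ : 0 ≤ γ)
    (hadv : IsAdversaryMatrix dom B) (hB : (d • (1 : Matrix dom dom ℂ) - B).PosSemidef)
    {v : dom → ℂ} (hv : B *ᵥ v = d • v) (hv1 : star v ⬝ᵥ v = 1) (t : ℕ) :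
    familyForm (tensorMatrix fun _ => multiplicativeMatrix B γ d)
        (P.weightedState (fun z => ∏ p, v (z p)) jointInput t) ≤ (1 + 2 * γ) ^ t := by
  induction t with
  | zero =>
    have h : multiplicativeMatrix B γ d *ᵥ v = v := by
      simp [multiplicativeMatrix, Matrix.add_mulVec, Matrix.sub_mulVec, Matrix.smul_mulVec, hv]
    rw [P.familyForm_weightedState_zero, quadForm, dotProduct_tensorMatrix_mulVec]
    simp [h, hv1]
  | succ t ih =>
    refine (familyForm_weightedState_succ_le P hγ hadv hB _ t).trans ?_
    rw [pow_succ']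
    exact mul_le_mul_of_nonneg_left ih (by linarith)

/-- The tensor product of the weights `α` for a correct bit and `β` for a wrong one is at most
`(α q + β (1 - q)) ^ k` times the progress measure, where `q = (1 + ε) / 2`.  Averaging
over the inputs with the distribution `|v| ^ 2` in each component bounds the probability of any
event on which the total weight is at least `L`. -/
theorem exists_input_prob_le {f : dom → Bool}
    (P : QueryAlgorithm (Fin k × Fin n) A R W (Fin k → Bool) T)
    {B : Matrix dom dom ℂ} {γ d ε α β L m : ℝ} (hε0 : 0 < ε) (hε1 : ε < 1) (hγ : 0 ≤ γ)
    (hγd : γ * d = (1 - ε) / (2 * ε)) (hoff : ∀ x y, f x = f y → B x y = 0)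
    (hadv : IsAdversaryMatrix dom B) (hB : (d • (1 : Matrix dom dom ℂ) - B).PosSemidef)
    {v : dom → ℂ} (hv : B *ᵥ v = d • v) (hv1 : star v ⬝ᵥ v = 1)
    (hβ : 0 ≤ β) (hβα : β ≤ α)
    (hL : ∀ c ≤ k, m ≤ (c : ℝ) → L ≤ α ^ c * β ^ (k - c)) :
    ∃ x : Fin k → dom, L * P.prob (jointInput x)
        (fun o => m ≤ ((correctOutputs f x o).card : ℝ)) ≤
      ((α - β) * ((1 + ε) / 2) + β) ^ k * (1 + 2 * γ) ^ T := by
  classical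
  set C := (α - β) * ((1 + ε) / 2) + β with hC
  have hC0 : 0 ≤ C := add_nonneg (mul_nonneg (by linarith) (by linarith)) hβ
  set V : (Fin k → dom) → ℂ := fun z => ∏ p, v (z p) with hV
  set G := multiplicativeMatrix B γ d with hG
  set w : Bool → dom → ℝ := fun o x => if o = f x then α else β with hw
  have hw0 : ∀ o x, 0 ≤ w o x := by
    intro o x; simp only [hw]; split_ifs <;> linarith
  have hnorm : ∑ z, ‖V z‖ ^ 2 = 1 := by
    have h := dotProduct_tensorMatrix_mulVec (ι := Fin k) (fun _ => (1 : Matrix dom dom ℂ)) v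
    have h1 : tensorMatrix (fun _ : Fin k => (1 : Matrix dom dom ℂ)) = 1 := by
      simpa using tensorMatrix_diagonal (ι := Fin k) (X := dom) fun _ _ => 1
    rw [h1] at h
    have h2 := quadForm_diagonal (fun _ : Fin k → dom => 1) V
    simp only [Complex.ofReal_one, Matrix.diagonal_one, one_mul] at h2
    rw [← h2, quadForm, hV, h]
    simp [hv1]
  -- `α` for each correct bit of the output `o` on input `z` and `β` for each wrong one.
  have hweight : ∀ (o : Fin k → Bool) (z : Fin k → dom),
      ∏ p, w (o p) (z p) =
        α ^ (correctOutputs f z o).card * β ^ (k - (correctOutputs f z o).card) := by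
    intro o z
    simp only [hw]
    rw [Finset.prod_ite, Finset.prod_const, Finset.prod_const, correctOutputs,
      Finset.filter_not, Finset.card_sdiff_of_subset (Finset.filter_subset _ _)]
    simp
  have hbasis : ∀ s, ∑ z, (∏ p, w (P.out s p) (z p)) * ‖P.weightedState V jointInput T z s‖ ^ 2 ≤
      C ^ k * quadForm (tensorMatrix fun _ => G) (fun z => P.weightedState V jointInput T z s) := by
    intro s
    have h := tensorMatrix_mono (ι := Fin k)
      (A := fun p => Matrix.diagonal fun x : dom => (w (P.out s p) x : ℂ)) (B := fun _ => C • G)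
      (fun p => Matrix.PosSemidef.diagonal fun x => by
        simpa using Complex.zero_le_real.2 (hw0 (P.out s p) x))
      (fun p => smul_multiplicativeMatrix_sub_weight_posSemidef hε0 hε1 hγ hγd hoff hB hβ hβα _)
    have h' := h.quadForm_nonneg fun z => P.weightedState V jointInput T z s
    rw [quadForm_sub, tensorMatrix_diagonal, quadForm_diagonal, tensorMatrix_const_smul,
      quadForm_smul, Fintype.card_fin] at h'
    linarith
  have hprob : ∑ z, ‖V z‖ ^ 2 * (L * P.prob (jointInput z)
      (fun o => m ≤ ((correctOutputs f z o).card : ℝ))) ≤ C ^ k * (1 + 2 * γ) ^ T := by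
    calc _ ≤ ∑ z, ∑ s, (∏ p, w (P.out s p) (z p)) *
            ‖P.weightedState V jointInput T z s‖ ^ 2 := by
          refine Finset.sum_le_sum fun z _ => ?_
          rw [QueryAlgorithm.prob, Finset.mul_sum, Finset.mul_sum]
          refine Finset.sum_le_sum fun s _ => ?_
          have hs : ‖P.weightedState V jointInput T z s‖ ^ 2 =
              ‖V z‖ ^ 2 * ‖P.state (jointInput z) T s‖ ^ 2 := by
            simp [QueryAlgorithm.weightedState, mul_pow]
          rw [hs]
          have h0 : 0 ≤ ‖V z‖ ^ 2 * ‖P.state (jointInput z) T s‖ ^ 2 := by positivity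
          split_ifs with hm
          · have hle : L ≤ ∏ p, w (P.out s p) (z p) := by
              rw [hweight]
              refine hL _ ?_ hm
              simpa using Finset.card_le_univ (correctOutputs f z (P.out s))
            linarith [mul_le_mul_of_nonneg_right hle h0]
          · simpa using mul_nonneg (Finset.prod_nonneg fun p _ => hw0 (P.out s p) (z p)) h0
      _ = ∑ s, ∑ z, (∏ p, w (P.out s p) (z p)) *
            ‖P.weightedState V jointInput T z s‖ ^ 2 := Finset.sum_comm
      _ ≤ C ^ k * familyForm (tensorMatrix fun _ => G) (P.weightedState V jointInput T) := by
          rw [familyForm, Finset.mul_sum]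
          exact Finset.sum_le_sum fun s _ => hbasis s
      _ ≤ C ^ k * (1 + 2 * γ) ^ T :=
          mul_le_mul_of_nonneg_left (familyForm_weightedState_le P hγ hadv hB hv hv1 T)
            (pow_nonneg hC0 k)
  by_contra! hlt
  have hne : ∃ z, V z ≠ 0 := by
    by_contra! h0
    simp [h0] at hnorm
  obtain ⟨z₀, hz₀⟩ := hne
  have hcontra : ∑ z, ‖V z‖ ^ 2 * (C ^ k * (1 + 2 * γ) ^ T) <
      ∑ z, ‖V z‖ ^ 2 * (L * P.prob (jointInput z)
        (fun o => m ≤ ((correctOutputs f z o).card : ℝ))) :=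
    Finset.sum_lt_sum (fun z _ => mul_le_mul_of_nonneg_left (hlt z).le (by positivity))
      ⟨z₀, Finset.mem_univ _, mul_lt_mul_of_pos_left (hlt z₀) (by positivity)⟩
  rw [← Finset.sum_mul, hnorm, one_mul] at hcontra
  linarith

end Progress

/-! ### Off-diagonal adversary matrices -/

section OffDiagonal

variable {X : Type*} [Fintype X] [DecidableEq X]

open scoped Matrix.Norms.L2Operator MatrixOrder in
/-- A Hermitian matrix that links only inputs with different values of `f` is negated when it is
conjugated by the signs of `f`.  Hence its norm is one of its eigenvalues. -/
theorem exists_top_eigenvector_of_off_diagonal {B : Matrix X X ℂ} (hB : B.IsHermitian)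
    {f : X → Bool} (hoff : ∀ x y, f x = f y → B x y = 0) (hpos : 0 < ‖B‖) :
    (‖B‖ • (1 : Matrix X X ℂ) - B).PosSemidef ∧
      ∃ v : X → ℂ, B *ᵥ v = ‖B‖ • v ∧ star v ⬝ᵥ v = 1 := by
  have hsa : IsSelfAdjoint B := hB
  refine ⟨?_, ?_⟩
  · have h : B ≤ algebraMap ℝ (Matrix X X ℂ) ‖B‖ := hsa.le_algebraMap_norm_self
    rwa [Algebra.algebraMap_eq_smul_one, Matrix.le_iff] at h
  have hnt : Nontrivial (Matrix X X ℂ) := ⟨B, 0, by simpa using hpos⟩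
  have heig : ∀ r : ℝ, r ∈ spectrum ℝ B → ∃ v : X → ℂ, v ≠ 0 ∧ B *ᵥ v = r • v := by
    intro r hr
    have hr' : (r : ℂ) ∈ spectrum ℂ (Matrix.toLin' B) := by
      rw [Matrix.spectrum_toLin']
      exact spectrum.algebraMap_mem ℂ hr
    obtain ⟨v, hv⟩ := (Module.End.hasEigenvalue_iff_mem_spectrum.2 hr').exists_hasEigenvector
    exact ⟨v, hv.2, by simpa using hv.apply_eq_smul⟩
  obtain ⟨u, hu0, hu⟩ : ∃ u : X → ℂ, u ≠ 0 ∧ B *ᵥ u = ‖B‖ • u := by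
    rcases CStarAlgebra.norm_or_neg_norm_mem_spectrum hsa with h | h
    · exact heig _ h
    · obtain ⟨u, hu0, hu⟩ := heig _ h
      have hsq : ∀ x, (if f x then (1 : ℂ) else -1) * (if f x then (1 : ℂ) else -1) = 1 := by
        intro x; split_ifs <;> simp
      refine ⟨fun x => (if f x then 1 else -1) * u x, fun h0 => hu0 ?_, ?_⟩
      · ext x
        have := congrFun h0 x
        by_cases hx : f x <;> simpa [hx] using this
      · ext x
        have hux := congrFun hu x
        simp only [Matrix.mulVec, dotProduct, Pi.smul_apply] at hux ⊢
        have : ∑ y, B x y * ((if f y then 1 else -1) * u y) =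
            -(if f x then 1 else -1) * ∑ y, B x y * u y := by
          rw [Finset.mul_sum]
          refine Finset.sum_congr rfl fun y _ => ?_
          by_cases hxy : f x = f y
          · simp [hoff x y hxy]
          · have : (if f y then (1 : ℂ) else -1) = -(if f x then 1 else -1) := by
              revert hxy; cases f x <;> cases f y <;> simp
            rw [this]; ring
        rw [this, hux]
        simp only [Complex.real_smul]
        push_cast; ring
  have hpos' : 0 < star u ⬝ᵥ u := Matrix.dotProduct_star_self_pos_iff.2 hu0
  obtain ⟨c, hc⟩ : ∃ c : ℝ, (c : ℂ) = star u ⬝ᵥ u :=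
    ⟨_, (Complex.eq_re_of_ofReal_le hpos'.le).symm⟩
  have hc0 : 0 < c := by rw [← hc] at hpos'; exact_mod_cast hpos'
  refine ⟨(√c)⁻¹ • u, ?_, ?_⟩
  · rw [Matrix.mulVec_smul, hu, smul_comm]
  · have h1 : (√c)⁻¹ * (√c)⁻¹ * c = 1 := by
      rw [← mul_inv, Real.mul_self_sqrt hc0.le, inv_mul_cancel₀ hc0.ne']
    rw [star_smul, smul_dotProduct, dotProduct_smul, ← hc]
    simp only [Complex.real_smul, star_trivial, ← mul_assoc]
    exact_mod_cast h1

end OffDiagonal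

section Adversary

variable {n : ℕ} {A : Type*} [DecidableEq A] {dom : Finset (Fin n → A)}

omit [DecidableEq A] in
theorem hadamard_allOnes_sub_gramMatrix_apply (Γ : Matrix dom dom ℂ) (f : dom → Bool)
    (x y : dom) : (Γ ⊙ (allOnes dom - gramMatrix f)) x y = if f x = f y then 0 else Γ x y := by
  by_cases h : f x = f y <;> simp [allOnes, gramMatrix, h]

theorem hadamard_allOnes_sub_coordMatrix_apply (Γ : Matrix dom dom ℂ) (i : Fin n)
    (x y : dom) :
    (Γ ⊙ (allOnes dom - coordMatrix dom i)) x y = if x.1 i = y.1 i then 0 else Γ x y := by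
  by_cases h : x.1 i = y.1 i <;> simp [allOnes, coordMatrix, h]

/-- Removing the diagonal blocks of an adversary matrix keeps it feasible: the result is the average
of the matrix and of minus its conjugate by the signs of `f`. -/
theorem IsAdversaryMatrix.hadamard_gramMatrix {Γ : Matrix dom dom ℂ}
    (hΓ : IsAdversaryMatrix dom Γ) (f : dom → Bool) :
    IsAdversaryMatrix dom (Γ ⊙ (allOnes dom - gramMatrix f)) := by
  set σ : dom → ℂ := fun x => if f x then 1 else -1 with hσ
  have hS : (Matrix.diagonal σ)ᴴ = Matrix.diagonal σ := by
    rw [Matrix.diagonal_conjTranspose]; congr 1; ext x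
    simp only [hσ, Pi.star_apply]; split_ifs <;> simp
  have hsame : ∀ x, σ x * σ x = 1 := by
    intro x; simp only [hσ]; split_ifs <;> simp
  have hdiff : ∀ x y, f x ≠ f y → σ x * σ y = -1 := by
    intro x y h; revert h; simp only [hσ]; cases f x <;> cases f y <;> simp
  have hmul : ∀ x y, σ x * σ y = if f x = f y then 1 else -1 := by
    intro x y
    split_ifs with h
    · rw [← hsame x]; simp only [hσ, h]
    · exact hdiff x y h
  have havg : ∀ M N : Matrix dom dom ℂ, (1 + M).PosSemidef → (1 - M).PosSemidef →
      (∀ x y, N x y = if f x = f y then 0 else M x y) → (1 + N).PosSemidef := by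
    intro M N h1 h2 hN
    have h3 := h2.mul_mul_conjTranspose_same (Matrix.diagonal σ)
    rw [hS] at h3
    convert! (h1.add h3).smul (by norm_num : (0 : ℝ) ≤ 1 / 2) using 1
    ext x y
    simp only [Matrix.add_apply, Matrix.smul_apply, Matrix.mul_diagonal, Matrix.diagonal_mul,
      Matrix.sub_apply, Complex.real_smul, hN]
    rw [mul_right_comm, hmul]
    by_cases hxy : x = y
    · subst hxy; simp; ring
    · simp only [Matrix.one_apply_ne hxy]
      split_ifs <;> push_cast <;> ring
  refine ⟨?_, fun i => ⟨?_, ?_⟩⟩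
  · refine Matrix.IsHermitian.ext fun x y => ?_
    simp only [hadamard_allOnes_sub_gramMatrix_apply, eq_comm (a := f y)]
    split_ifs
    · simp
    · exact hΓ.1.apply x y
  · refine havg _ _ (hΓ.2 i).1 (hΓ.2 i).2 fun x y => ?_
    simp only [hadamard_allOnes_sub_gramMatrix_apply, hadamard_allOnes_sub_coordMatrix_apply]
    split_ifs <;> rfl
  · rw [sub_eq_add_neg]
    refine havg (-(Γ ⊙ (allOnes dom - coordMatrix dom i))) _ ?_ ?_ fun x y => ?_
    · rw [← sub_eq_add_neg]; exact (hΓ.2 i).2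
    · rw [sub_neg_eq_add]; exact (hΓ.2 i).1
    · simp only [Matrix.neg_apply, hadamard_allOnes_sub_gramMatrix_apply,
        hadamard_allOnes_sub_coordMatrix_apply]
      split_ifs <;> simp

theorem isAdversaryMatrix_zero : IsAdversaryMatrix dom 0 :=
  ⟨Matrix.isHermitian_zero, fun i => by simp [Matrix.PosSemidef.one]⟩

/-- The matrix that links just two inputs is feasible, so a non-constant function has an adversary
matrix with a nonzero value. -/
theorem exists_adversaryMatrix_apply_ne_zero {a b : dom} (hab : a ≠ b) :
    ∃ Γ : Matrix dom dom ℂ, IsAdversaryMatrix dom Γ ∧ Γ a b ≠ 0 := by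
  set Γ : Matrix dom dom ℂ := Matrix.single a b 1 + Matrix.single b a 1 with hΓ
  have hH : Γ.IsHermitian := by
    rw [Matrix.IsHermitian, hΓ, Matrix.conjTranspose_add, Matrix.conjTranspose_single,
      Matrix.conjTranspose_single, add_comm]
    simp
  have hdiag : ∀ x, 0 ≤ (if x = a ∨ x = b then (0 : ℂ) else 1) := by
    intro x; split_ifs <;> simp
  -- `1 ± Γ` is the projection off `a` and `b` plus the Gram matrix of the vector `e_a ± e_b`.
  have hps : ∀ c : ℂ, c = 1 ∨ c = -1 → (1 + c • Γ).PosSemidef := by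
    intro c hc
    convert! (Matrix.PosSemidef.diagonal (n := dom) hdiag).add
      (Matrix.posSemidef_vecMulVec_self_star (Pi.single a 1 + Pi.single b c : dom → ℂ)) using 1
    ext x y
    have hcs : star c = c := by rcases hc with rfl | rfl <;> simp
    have hcc : c * c = 1 := by rcases hc with rfl | rfl <;> simp
    simp only [hΓ, Matrix.add_apply, Matrix.smul_apply, Matrix.single_apply, Matrix.one_apply,
      Matrix.diagonal_apply, Matrix.vecMulVec_apply, Pi.add_apply, Pi.star_apply, Pi.single_apply,
      star_add, apply_ite star, star_one, star_zero, hcs, smul_eq_mul]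
    grind
  refine ⟨Γ, ⟨hH, fun i => ?_⟩, by simp [hΓ, hab, hab.symm]⟩
  have hcases : Γ ⊙ (allOnes dom - coordMatrix dom i) = 0 ∨
      Γ ⊙ (allOnes dom - coordMatrix dom i) = Γ := by
    have hz : ∀ x y, ¬ (x = a ∧ y = b) → ¬ (x = b ∧ y = a) → Γ x y = 0 := by
      intro x y h1 h2
      simp only [hΓ, Matrix.add_apply, Matrix.single_apply]
      grind
    by_cases h : a.1 i = b.1 i
    · left
      ext x y
      rw [hadamard_allOnes_sub_coordMatrix_apply]
      by_cases h1 : x = a ∧ y = b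
      · simp [h1.1, h1.2, h]
      · by_cases h2 : x = b ∧ y = a
        · simp [h2.1, h2.2, h]
        · simp [hz x y h1 h2]
    · right
      ext x y
      rw [hadamard_allOnes_sub_coordMatrix_apply]
      split_ifs with hxy
      · refine (hz x y ?_ ?_).symm
        · rintro ⟨rfl, rfl⟩; exact h hxy
        · rintro ⟨rfl, rfl⟩; exact h hxy.symm
      · rfl
  have h1 := hps 1 (Or.inl rfl)
  have h2 := hps (-1) (Or.inr rfl)
  rw [one_smul] at h1
  rw [neg_smul, one_smul, ← sub_eq_add_neg] at h2
  rcases hcases with h | h <;> rw [h]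
  · simp [Matrix.PosSemidef.one]
  · exact ⟨h1, h2⟩

/-- The form in which the adversary bound is used: a feasible off-diagonal matrix with a positive
top eigenvalue `d`, which may be taken larger than half the adversary bound. -/
theorem exists_off_diagonal_adversaryMatrix {f : dom → Bool} (hf : ∃ x y, f x ≠ f y) :
    ∃ (B : Matrix dom dom ℂ) (d : ℝ), 0 < d ∧ additiveAdversary dom (gramMatrix f) ≤ 2 * d ∧
      IsAdversaryMatrix dom B ∧ (∀ x y, f x = f y → B x y = 0) ∧
      (d • (1 : Matrix dom dom ℂ) - B).PosSemidef ∧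
      ∃ v : dom → ℂ, B *ᵥ v = d • v ∧ star v ⬝ᵥ v = 1 := by
  obtain ⟨Γ, hΓ, hpos, hle⟩ : ∃ Γ : Matrix dom dom ℂ, IsAdversaryMatrix dom Γ ∧
      0 < ‖Matrix.toEuclideanCLM (n := dom) (𝕜 := ℂ) (Γ ⊙ (allOnes dom - gramMatrix f))‖ ∧
      additiveAdversary dom (gramMatrix f) ≤
        2 * ‖Matrix.toEuclideanCLM (n := dom) (𝕜 := ℂ) (Γ ⊙ (allOnes dom - gramMatrix f))‖ := by
    rcases le_or_gt (additiveAdversary dom (gramMatrix f)) 0 with h0 | h0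
    · obtain ⟨a, b, hab⟩ := hf
      obtain ⟨Γ, hΓ, hne⟩ := exists_adversaryMatrix_apply_ne_zero (a := a) (b := b)
        fun h => hab (h ▸ rfl)
      refine ⟨Γ, hΓ, ?_, h0.trans (by positivity)⟩
      rw [norm_pos_iff, Ne, EmbeddingLike.map_eq_zero_iff]
      intro h
      have := congrFun (congrFun h a) b
      rw [hadamard_allOnes_sub_gramMatrix_apply, if_neg hab] at this
      exact hne this
    · obtain ⟨r, ⟨Γ, hΓ, rfl⟩, hr⟩ := exists_lt_of_lt_csSup
        (s := {r : ℝ | ∃ Γ : Matrix dom dom ℂ, IsAdversaryMatrix dom Γ ∧ r =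
          ‖Matrix.toEuclideanCLM (n := dom) (𝕜 := ℂ) (Γ ⊙ (allOnes dom - gramMatrix f))‖})
        ⟨_, 0, isAdversaryMatrix_zero, rfl⟩ (half_lt_self h0)
      exact ⟨Γ, hΓ, (half_pos h0).trans hr, ((div_lt_iff₀' two_pos).1 hr).le⟩
  have hoff : ∀ x y, f x = f y → (Γ ⊙ (allOnes dom - gramMatrix f)) x y = 0 := fun x y h => by
    rw [hadamard_allOnes_sub_gramMatrix_apply, if_pos h]
  have hadv := hΓ.hadamard_gramMatrix f
  obtain ⟨h1, h2⟩ := exists_top_eigenvector_of_off_diagonal hadv.1 hoff hpos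
  exact ⟨_, _, hpos, hle, hadv, hoff, h1, h2⟩

end Adversary

/-! ### The Chernoff weights -/

/-- If correct and wrong bits are rewarded by the likelihood ratios `μ / q` and
`(1 - μ) / (1 - q)`, then any outcome with at least `μ k` correct bits out of `k` has total reward
at least `exp (k D(μ ‖ q))`. -/
theorem exp_mul_binaryRelEntropy_le {q μ : ℝ} (hq0 : 0 < q) (hq1 : q < 1) (hqμ : q ≤ μ)
    (hμ1 : μ ≤ 1) {k c : ℕ} (hck : c ≤ k) (hc : μ * k ≤ c) :
    Real.exp (k * binaryRelEntropy μ q) ≤ (μ / q) ^ c * ((1 - μ) / (1 - q)) ^ (k - c) := by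
  have hα : 0 < μ / q := div_pos (by linarith) hq0
  rcases hμ1.eq_or_lt with rfl | hμ
  · have : c = k := le_antisymm hck (by exact_mod_cast (one_mul (k : ℝ)) ▸ hc)
    subst this
    rw [Nat.sub_self, pow_zero, mul_one, binaryRelEntropy, sub_self, zero_mul, add_zero, one_mul,
      Real.exp_nat_mul, Real.exp_log hα]
  · have hβ : 0 < (1 - μ) / (1 - q) := div_pos (by linarith) (by linarith)
    have hβα : (1 - μ) / (1 - q) ≤ μ / q :=
      ((div_le_one (by linarith)).2 (by linarith)).trans ((one_le_div hq0).2 hqμ)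
    have hlog := Real.log_le_log hβ hβα
    have hsplit : (μ / q) ^ c * ((1 - μ) / (1 - q)) ^ (k - c) =
        Real.exp (c * Real.log (μ / q) + (k - c) * Real.log ((1 - μ) / (1 - q))) := by
      rw [Real.exp_add, Real.exp_nat_mul, Real.exp_log hα, ← Nat.cast_sub hck, Real.exp_nat_mul,
        Real.exp_log hβ]
    rw [hsplit, Real.exp_le_exp, binaryRelEntropy]
    linarith [mul_nonneg (sub_nonneg.2 hc) (sub_nonneg.2 hlog)]

theorem mainTheorem3 {n : ℕ} {A : Type*} [Fintype A] [DecidableEq A]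
    (dom : Finset (Fin n → A)) (f : dom → Bool) (hf : ∃ x y : dom, f x ≠ f y)
    (δ μ : ℝ) (hδ0 : 0 ≤ δ) (hδ1 : δ < 1)
    (hμ0 : (1 + Real.sqrt δ) / 2 ≤ μ) (hμ1 : μ ≤ 1)
    (k K : ℕ) (hk : 0 < k) (hK : 0 < K) (T : ℕ)
    {R W : Type*} [AddCommGroup R] [Fintype R] [DecidableEq R] [Fintype W] [DecidableEq W]
    (P : QueryAlgorithm (Fin k × Fin n) A R W (Fin k → Bool) T)
    (hT : (T : ℝ) ≤ k * δ / (K * (1 - δ)) * additiveAdversary dom (gramMatrix f)) :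
    ∃ x : Fin k → dom,
      P.prob (jointInput x) (fun o => μ * k ≤ ((correctOutputs f x o).card : ℝ)) ≤
        Real.exp (k / K - k * binaryRelEntropy μ ((1 + Real.sqrt δ) / 2)) := by
  obtain ⟨B, d, hd, hdadv, hadv, hoff, hB, v, hv, hv1⟩ := exists_off_diagonal_adversaryMatrix hf
  have hKpos : (0 : ℝ) < K := by exact_mod_cast hK
  have hs0 := Real.sqrt_nonneg δ
  have hs1 : √δ < 1 := by rw [Real.sqrt_lt' one_pos]; simpa using hδ1
  set q := (1 + √δ) / 2 with hq
  have hq0 : 0 < q := by linarith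
  have hq1 : q < 1 := by linarith
  have hβ : 0 ≤ (1 - μ) / (1 - q) := div_nonneg (by linarith) (by linarith)
  have hβα : (1 - μ) / (1 - q) ≤ μ / q :=
    ((div_le_one (by linarith)).2 (by linarith)).trans ((one_le_div hq0).2 hμ0)
  have hαq : μ / q * q = μ := div_mul_cancel₀ _ hq0.ne'
  have hβq : (1 - μ) / (1 - q) * (1 - q) = 1 - μ := div_mul_cancel₀ _ (by linarith)
  -- It remains to choose the deviation `ε` for which the loss is at most `exp (k / K)`.
  suffices h : ∃ ε : ℝ, 0 < ε ∧ ε < 1 ∧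
      ((μ / q - (1 - μ) / (1 - q)) * ((1 + ε) / 2) + (1 - μ) / (1 - q)) ^ k *
        (1 + 2 * ((1 - ε) / (2 * ε) / d)) ^ T ≤ Real.exp (k / K) by
    obtain ⟨ε, hε0, hε1, hle⟩ := h
    obtain ⟨x, hx⟩ := exists_input_prob_le P hε0 hε1
      (div_nonneg (div_nonneg (by linarith) (by linarith)) hd.le : 0 ≤ (1 - ε) / (2 * ε) / d)
      (div_mul_cancel₀ _ hd.ne') hoff hadv hB hv hv1 hβ hβα
      fun c hck hc => exp_mul_binaryRelEntropy_le hq0 hq1 hμ0 hμ1 hck hc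
    refine ⟨x, ?_⟩
    rw [Real.exp_sub, le_div_iff₀ (Real.exp_pos _), mul_comm]
    exact hx.trans hle
  rcases hδ0.eq_or_lt with rfl | hδ
  · -- Without queries the exact value `ε = 0` is out of reach, but any small `ε` will do.
    have hT0 : T = 0 := by
      have : (T : ℝ) ≤ 0 := by simpa using hT
      exact_mod_cast this.antisymm (Nat.cast_nonneg T)
    have hε0 : (0 : ℝ) < 1 / (K + 1) := by positivity
    have hεK : 1 / ((K : ℝ) + 1) ≤ 1 / K := one_div_le_one_div_of_le hKpos (by linarith)
    have hq2 : q = 1 / 2 := by rw [hq, Real.sqrt_zero]; norm_num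
    refine ⟨1 / (K + 1), hε0, (div_lt_one (by linarith)).2 (by linarith), ?_⟩
    rw [hT0, pow_zero, mul_one, div_eq_mul_one_div (k : ℝ), Real.exp_nat_mul]
    refine pow_le_pow_left₀ (add_nonneg (mul_nonneg (by linarith) (by linarith)) hβ) ?_ k
    rw [hq2] at hαq hβq ⊢
    have h1 : μ / (1 / 2) = 2 * μ := by linarith
    have h2 : (1 - μ) / (1 - 1 / 2) = 2 * (1 - μ) := by linarith
    rw [h1, h2]
    have h3 : (1 - μ) * (1 / ((K : ℝ) + 1)) ≥ 0 := mul_nonneg (by linarith) hε0.le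
    have h4 := Real.add_one_le_exp (1 / (K : ℝ))
    linarith
  · have hs : 0 < √δ := Real.sqrt_pos.2 hδ
    refine ⟨√δ, hs, hs1, ?_⟩
    have hC : (μ / q - (1 - μ) / (1 - q)) * ((1 + √δ) / 2) + (1 - μ) / (1 - q) = 1 := by
      rw [← hq]; linarith
    rw [hC, one_pow, one_mul]
    have hγ0 : 0 ≤ 2 * ((1 - √δ) / (2 * √δ) / d) :=
      mul_nonneg two_pos.le (div_nonneg (div_nonneg (by linarith) (by linarith)) hd.le)
    have hTd : (T : ℝ) ≤ k * δ / (K * (1 - δ)) * (2 * d) :=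
      hT.trans (mul_le_mul_of_nonneg_left hdadv
        (div_nonneg (by positivity) (mul_nonneg hKpos.le (by linarith))))
    calc (1 + 2 * ((1 - √δ) / (2 * √δ) / d)) ^ T
        ≤ Real.exp (2 * ((1 - √δ) / (2 * √δ) / d)) ^ T :=
          pow_le_pow_left₀ (by linarith)
            (by linarith [Real.add_one_le_exp (2 * ((1 - √δ) / (2 * √δ) / d))]) T
      _ = Real.exp (T * (2 * ((1 - √δ) / (2 * √δ) / d))) := (Real.exp_nat_mul _ _).symm
      _ ≤ Real.exp (k / K) := by
          rw [Real.exp_le_exp]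
          refine (mul_le_mul_of_nonneg_right hTd hγ0).trans ?_
          -- With `δ = √δ ^ 2` the left side is `k / K` times `2 √δ / (1 + √δ) ≤ 1`.
          have hsq : δ = √δ * √δ := (Real.mul_self_sqrt hδ0).symm
          have heq : k * δ / (K * (1 - δ)) * (2 * d) * (2 * ((1 - √δ) / (2 * √δ) / d)) =
              k / K * (2 * √δ / (1 + √δ)) := by
            have hne : 1 - √δ ≠ 0 := by linarith
            have hne' : 1 + √δ ≠ 0 := by linarith
            have hfac : 1 - δ = (1 - √δ) * (1 + √δ) := by
              rw [sub_mul, one_mul, mul_add, ← hsq]; ring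
            have hnum : (k : ℝ) * δ = k * (√δ * √δ) := by rw [← hsq]
            rw [hfac, hnum]
            field_simp
          rw [heq]
          exact mul_le_of_le_one_right (by positivity)
            ((div_le_one (by linarith)).2 (by linarith))
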